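/- Let $X=\ell^2(\mathbb{Z})$ be the complex Hilbert space of square-summable sequences with inner product $\langle\cdot,\cdot\rangle$ (linear in the first argument), and fix an orthonormal basis $(e_i)_{i\in\mathbb{Z}}$ of $X$. For a bounded linear operator $A$ on $X$ put $A_{i,j}=\langle Ae_j,e_i\rangle$, let $\operatorname{spec}(A)=\{\lambda\in\mathbb{C}: A-\lambda I \text{ is not invertible}\}$, and let \[N(A)=\operatorname{clos}\{\langle Ax,x\rangle : x\in X,\ \|x\|=1\}\] be its closed numerical range. Let $U_{-1},U_0,U_1\subset\mathbb{C}$ be non-empty compact sets. Let $M(U_{-1},U_0,U_1)$ be the set of bounded operators $A$ on $X$ such that, for all $i,k\in\mathbb{Z}$, $A_{i+k,i}\in U_k$ if $k\in\{-1,0,1\}$ and $A_{i+k,i}=0$ otherwise; let $M_{fin}(U_{-1},U_0,U_1)$ be the set of all finite square matrices with the same property. An operator $A\in M(U_{-1},U_0,U_1)$ is a Laurent operator, $A\in L(U_{-1},U_0,U_1)$, if $A_{i,j}=A_{i+1,j+1}$ for all $i,j\in\mathbb{Z}$. It is pseudo-ergodic, $A\in\Psi E(U_{-1},U_0,U_1)$,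 if for all $\epsilon>0$ and all $B\in M_{fin}(U_{-1},U_0,U_1)$ there exist integers $k$ and $l$, with $l-k+1$ equal to the size of $B$, such that $\|P_{k,l}AP_{k,l}-B\|\le\epsilon$, where $P_{k,l}$ is the orthogonal projection onto $\operatorname{span}\{e_k,\dots,e_l\}$, $P_{k,l}AP_{k,l}$ is identified with the matrix $(A_{i,j})_{k\le i,j\le l}$, and $\|\cdot\|$ is the operator norm for the Euclidean norm. **Theorem.** For every $A\in\Psi E(U_{-1},U_0,U_1)$, \[N(A)=\operatorname{conv}\Bigl(\bigcup_{B\in L(U_{-1},U_0,U_1)}\operatorname{spec}(B)\Bigr)=\operatorname{conv}\Bigl(\bigcup_{u_{-1}\in U_{-1},\,u_0\in U_0,\,u_1\in U_1}\{u_{-1}e^{i\theta}+u_0+u_1e^{-i\theta}:\theta\in[0,2\pi)\}\Bigr).\] In particular, $\operatorname{spec}(A)=N(A)$ if $\bigcup_{B\in L(U_{-1},U_0,U_1)}\operatorname{spec}(B)$ is convex. -/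

import Mathlib

namespace BandOp

noncomputable section

/-- The Hilbert space of square-summable complex sequences indexed by the integers. -/
abbrev X : Type := lp (fun _ : ℤ => ℂ) 2

/-- The entry `A_{i,j}` of an operator with respect to the orthonormal basis `e`. Mathlib's inner
product is linear in its second argument, so this is `⟨A e_j, e_i⟩` for the inner product that is
linear in its first argument. -/
def entry (e : HilbertBasis ℤ ℂ X) (A : X →L[ℂ] X) (i j : ℤ) : ℂ :=
  inner ℂ (e i) (A (e j))

/-- `M(U_n, …, U_m)`: the bounded operators whose `k`-th diagonal `(A_{i+k,i})_i` has all its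
entries in `U k` if `n ≤ k ≤ m`, and vanishes otherwise. The sets `U k` with `k` outside
`[n, m]` play no role. -/
def M (e : HilbertBasis ℤ ℂ X) (n m : ℤ) (U : ℤ → Set ℂ) : Set (X →L[ℂ] X) :=
  {A | ∀ i k : ℤ, (n ≤ k ∧ k ≤ m → entry e A (i + k) i ∈ U k) ∧
    (¬(n ≤ k ∧ k ≤ m) → entry e A (i + k) i = 0)}

/-- The matrices of size `N × N` in `M_fin(U_n, …, U_m)`: the entry in row `i` and column `j`
lies on the diagonal with index `i - j`. -/
def MFin (n m : ℤ) (U : ℤ → Set ℂ) (N : ℕ) : Set (Matrix (Fin N) (Fin N) ℂ) :=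
  {B | ∀ i j : Fin N,
    (n ≤ (i : ℤ) - (j : ℤ) ∧ (i : ℤ) - (j : ℤ) ≤ m → B i j ∈ U ((i : ℤ) - (j : ℤ))) ∧
    (¬(n ≤ (i : ℤ) - (j : ℤ) ∧ (i : ℤ) - (j : ℤ) ≤ m) → B i j = 0)}

/-- The `N × N` matrix of the compression `P_{k,l} A P_{k,l}` to the span of `e_k, …, e_l`,
where `l = k + N - 1`. -/
def compression (e : HilbertBasis ℤ ℂ X) (A : X →L[ℂ] X) (k : ℤ) (N : ℕ) :
    Matrix (Fin N) (Fin N) ℂ :=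
  Matrix.of fun i j => entry e A (k + (i : ℤ)) (k + (j : ℤ))

/-- The operator norm of a square matrix acting on `ℂ^N` with the Euclidean norm. -/
def matrixNorm {N : ℕ} (B : Matrix (Fin N) (Fin N) ℂ) : ℝ :=
  ‖Matrix.toEuclideanCLM (𝕜 := ℂ) B‖

/-- `ΨE(U_n, …, U_m)`: the pseudo-ergodic operators. -/
def PsiE (e : HilbertBasis ℤ ℂ X) (n m : ℤ) (U : ℤ → Set ℂ) : Set (X →L[ℂ] X) :=
  {A | A ∈ M e n m U ∧ ∀ ε : ℝ, 0 < ε → ∀ N : ℕ, ∀ B ∈ MFin n m U N,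
    ∃ k : ℤ, matrixNorm (compression e A k N - B) ≤ ε}

/-- `L(U_n, …, U_m)`: the Laurent operators, constant along each diagonal. -/
def L (e : HilbertBasis ℤ ℂ X) (n m : ℤ) (U : ℤ → Set ℂ) : Set (X →L[ℂ] X) :=
  {A | A ∈ M e n m U ∧ ∀ i j : ℤ, entry e A i j = entry e A (i + 1) (j + 1)}

/-- The closed numerical range, the closure of `{⟨A x, x⟩ : ‖x‖ = 1}`. -/
def numericalRange (A : X →L[ℂ] X) : Set ℂ :=
  closure {z : ℂ | ∃ x : X, ‖x‖ = 1 ∧ inner ℂ x (A x) = z}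

/-- The curve `{u₋₁ e^{iθ} + u₀ + u₁ e^{-iθ} : θ ∈ [0, 2π)}`, with `a = u₋₁`, `b = u₀`,
`c = u₁`. -/
def symbolCurve (a b c : ℂ) : Set ℂ :=
  {z : ℂ | ∃ θ ∈ Set.Ico (0 : ℝ) (2 * Real.pi),
    z = a * Complex.exp (Complex.I * θ) + b + c * Complex.exp (-(Complex.I * θ))}

end

end BandOp

namespace BandOp

open scoped ComplexConjugate InnerProductSpace

/-! Let `K` be the union of the symbol curves. With `w = e^{iθ}`, the maximum of `re (α z)` over the
curve of `(a, b, c)` is `re (α b) + ‖α a + conj (α c)‖`. The real part of `α ⟪x, A x⟫` is a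
tridiagonal Hermitian form whose diagonal and neighbour couplings obey the same two bounds
(`re_mul_inner_apply_le`). Hence every closed half-plane containing `K` contains the numerical
range, and compactness of the hull finishes this inclusion. It holds for all of `M`.

Conversely, pseudo-ergodicity supplies long blocks on which `A` nearly has constant diagonals `a`,
`b`, `c`. Truncated plane waves there are approximate eigenvectors, so `K ⊆ spectrum ℂ A`
(`symbolCurve_subset_spectrum`). The spectrum lies in the numerical range, which is convex by
Toeplitz–Hausdorff.

A Laurent operator has exactly constant diagonals, so the same waves put its curve in its spectrum;
spectral mapping for the unitary shift gives the converse. -/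

/-! ### Compactness of convex hulls -/

lemma isCompact_convexJoin {E : Type*} [AddCommGroup E] [Module ℝ E] [TopologicalSpace E]
    [ContinuousAdd E] [ContinuousSMul ℝ E] {s t : Set E} (hs : IsCompact s) (ht : IsCompact t) :
    IsCompact (convexJoin ℝ s t) := by
  have himage : convexJoin ℝ s t =
      (fun p : ℝ × E × E => (1 - p.1) • p.2.1 + p.1 • p.2.2) '' (Set.Icc 0 1 ×ˢ s ×ˢ t) := by
    ext x
    simp only [mem_convexJoin, segment_eq_image, Set.mem_image, Set.mem_prod, Prod.exists]
    constructor
    · rintro ⟨a, ha, b, hb, r, hr, rfl⟩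
      exact ⟨r, a, b, ⟨hr, ha, hb⟩, rfl⟩
    · rintro ⟨r, a, b, ⟨hr, ha, hb⟩, rfl⟩
      exact ⟨a, ha, b, hb, r, hr, rfl⟩
  rw [himage]
  exact (isCompact_Icc.prod (hs.prod ht)).image (by fun_prop)

/-- The convex hull of a compact set in a finite-dimensional space is compact. -/
theorem isCompact_convexHull {E : Type*} [NormedAddCommGroup E] [NormedSpace ℝ E]
    [FiniteDimensional ℝ E] {s : Set E} (hs : IsCompact s) : IsCompact (convexHull ℝ s) := by
  classical
  rcases s.eq_empty_or_nonempty with rfl | hne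
  · rw [convexHull_empty]; exact isCompact_empty
  let D : ℕ → Set E := fun n => (convexJoin ℝ s)^[n] s
  have hD (n : ℕ) : D (n + 1) = convexJoin ℝ s (D n) := Function.iterate_succ_apply' _ _ _
  have hcompact (n : ℕ) : IsCompact (D n) := by
    induction n with
    | zero => exact hs
    | succ n ih => rw [hD]; exact isCompact_convexJoin hs ih
  have hsub (n : ℕ) : D n ⊆ convexHull ℝ s := by
    induction n with
    | zero => exact subset_convexHull ℝ s
    | succ n ih =>
      rw [hD]
      exact convexJoin_subset (subset_convexHull ℝ s) ih (convex_convexHull ℝ s)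
  have hmono : Monotone D :=
    monotone_nat_of_le_succ fun n => by rw [hD]; exact subset_convexJoin_right hne
  have hfin (t : Finset E) (ht : (t : Set E) ⊆ s) : convexHull ℝ (t : Set E) ⊆ D t.card := by
    induction t using Finset.induction_on with
    | empty => simp
    | insert x t hx ih =>
      rw [Finset.coe_insert, Set.insert_subset_iff] at ht
      rw [Finset.coe_insert, Finset.card_insert_of_notMem hx, hD]
      rcases (t : Set E).eq_empty_or_nonempty with h | h
      · rw [h, insert_empty_eq, convexHull_singleton, Set.singleton_subset_iff]
        exact subset_convexJoin_left (hne.mono (hmono (Nat.zero_le _))) ht.1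
      · rw [convexHull_insert h]
        exact convexJoin_mono (Set.singleton_subset_iff.mpr ht.1) (ih ht.2)
  -- Carathéodory: affinely independent sets have at most `finrank + 1` points, so the increasing
  -- sets `D n` exhaust the hull by this index.
  have heq : convexHull ℝ s = D (Module.finrank ℝ E + 1) := by
    refine Set.Subset.antisymm ?_ (hsub _)
    rw [convexHull_eq_union]
    simp only [Set.iUnion_subset_iff]
    intro t ht hind
    refine (hfin t ht).trans (hmono ?_)
    have := hind.card_le_finrank_succ
    rw [Fintype.card_coe] at this
    exact this.trans (Nat.succ_le_succ (Submodule.finrank_le _))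
  rw [heq]
  exact hcompact _

/-! ### Convexity of the numerical range -/

section NumericalRange

variable {E : Type*} [NormedAddCommGroup E] [InnerProductSpace ℂ E]

lemma exists_norm_eq_one_mul_eq_norm (s : ℂ) : ∃ w : ℂ, ‖w‖ = 1 ∧ w * s = (‖s‖ : ℂ) := by
  rcases eq_or_ne s 0 with rfl | hs
  · exact ⟨1, by simp⟩
  · have hs' : (‖s‖ : ℂ) ≠ 0 := by exact_mod_cast norm_ne_zero_iff.mpr hs
    refine ⟨conj s / ‖s‖, ?_, ?_⟩
    · rw [norm_div, RCLike.norm_conj, Complex.norm_real, norm_norm,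
        div_self (norm_ne_zero_iff.mpr hs)]
    · rw [div_mul_eq_mul_div, div_eq_iff hs', Complex.conj_mul', sq]

/-- A phase on `x` makes the cross terms of the form real. The Rayleigh quotient along the segment
from `x` to `y` is then real and continuous, and the intermediate value theorem applies. -/
lemma exists_unit_vector_of_inner_eq_zero_one (T : E →L[ℂ] E) {x y : E} (hx : ‖x‖ = 1)
    (hy : ‖y‖ = 1) (hTx : ⟪x, T x⟫_ℂ = 0) (hTy : ⟪y, T y⟫_ℂ = 1) {t : ℝ}
    (ht : t ∈ Set.Icc (0 : ℝ) 1) : ∃ z : E, ‖z‖ = 1 ∧ ⟪z, T z⟫_ℂ = t := by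
  obtain ⟨u, hu, hu'⟩ :=
    exists_norm_eq_one_mul_eq_norm (⟪y, T x⟫_ℂ - conj ⟪x, T y⟫_ℂ)
  have hx' : ‖u • x‖ = 1 := by rw [norm_smul, hu, hx, one_mul]
  have hTx' : ⟪u • x, T (u • x)⟫_ℂ = 0 := by
    rw [map_smul, inner_smul_left, inner_smul_right, hTx, mul_zero, mul_zero]
  have him : (⟪u • x, T y⟫_ℂ + ⟪y, T (u • x)⟫_ℂ).im = 0 := by
    rw [map_smul, inner_smul_left, inner_smul_right]
    have := congrArg Complex.im hu'
    rw [Complex.ofReal_im] at this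
    simp only [Complex.mul_im, Complex.sub_re, Complex.sub_im, Complex.conj_re, Complex.conj_im,
      Complex.add_im] at this ⊢
    linarith
  generalize u • x = x' at *
  set r : ℝ := (⟪x', T y⟫_ℂ + ⟪y, T x'⟫_ℂ).re with hr
  have hrr : ⟪x', T y⟫_ℂ + ⟪y, T x'⟫_ℂ = r := Complex.ext (by simp [hr]) (by simp [him])
  let v : ℝ → E := fun s => ((1 - s : ℝ) : ℂ) • x' + (s : ℂ) • y
  have hv : Continuous v := by fun_prop
  have hTv (s : ℝ) : ⟪v s, T (v s)⟫_ℂ = ((s ^ 2 + s * (1 - s) * r : ℝ) : ℂ) := by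
    simp only [v, map_add, map_smul, inner_add_left, inner_add_right, inner_smul_left,
      inner_smul_right, hTx', hTy, Complex.conj_ofReal]
    push_cast
    linear_combination (s : ℂ) * (1 - s) * hrr
  -- If `v s` vanished, the form values `0` and `s ^ 2` of its two summands would agree, forcing `s
  -- = 0` and then `x' = 0`.
  have hv0 (s : ℝ) : v s ≠ 0 := by
    intro h
    have h1 : ((1 - s : ℝ) : ℂ) • x' = -((s : ℂ) • y) := eq_neg_of_add_eq_zero_left h
    have h2 : ⟪((1 - s : ℝ) : ℂ) • x', T (((1 - s : ℝ) : ℂ) • x')⟫_ℂ = 0 := by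
      rw [map_smul, inner_smul_left, inner_smul_right, hTx', mul_zero, mul_zero]
    rw [h1, map_neg, inner_neg_neg, map_smul, inner_smul_left, inner_smul_right, hTy] at h2
    have hs : s = 0 := by simpa using h2
    rw [hs] at h1
    have h3 : x' = 0 := by simpa using h1
    rw [h3, norm_zero] at hx'
    exact zero_ne_one hx'
  have hv0' (s : ℝ) : ‖v s‖ ≠ 0 := norm_ne_zero_iff.mpr (hv0 s)
  let φ : ℝ → ℝ := fun s => (s ^ 2 + s * (1 - s) * r) / ‖v s‖ ^ 2
  have hφ : Continuous φ :=
    Continuous.div (by fun_prop) (by fun_prop) fun s => pow_ne_zero 2 (hv0' s)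
  have hφ0 : φ 0 = 0 := by simp [φ]
  have hφ1 : φ 1 = 1 := by simp [φ, v, hy]
  obtain ⟨s, -, hs⟩ := intermediate_value_Icc zero_le_one hφ.continuousOn
    (show t ∈ Set.Icc (φ 0) (φ 1) by rwa [hφ0, hφ1])
  refine ⟨((‖v s‖⁻¹ : ℝ) : ℂ) • v s, ?_, ?_⟩
  · rw [norm_smul, Complex.norm_real, norm_inv, norm_norm, inv_mul_cancel₀ (hv0' s)]
  · rw [map_smul, inner_smul_left, inner_smul_right, Complex.conj_ofReal, hTv, ← hs]
    simp only [φ]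
    push_cast
    field_simp

/-- The **Toeplitz–Hausdorff theorem**: the numerical range of a bounded operator is convex. -/
theorem convex_setOf_inner_apply (T : E →L[ℂ] E) :
    Convex ℝ {z : ℂ | ∃ x : E, ‖x‖ = 1 ∧ ⟪x, T x⟫_ℂ = z} := by
  rintro p ⟨x, hx, hp⟩ q ⟨y, hy, hq⟩ s t hs ht hst
  rcases eq_or_ne q p with h | h
  · exact ⟨x, hx, by rw [hp, h, ← add_smul, hst, one_smul]⟩
  have hqp : q - p ≠ 0 := sub_ne_zero.mpr h
  have hform (z : E) (hz : ‖z‖ = 1) :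
      ⟪z, ((q - p)⁻¹ • (T - p • (1 : E →L[ℂ] E))) z⟫_ℂ = (q - p)⁻¹ * (⟪z, T z⟫_ℂ - p) := by
    simp [inner_self_eq_norm_sq_to_K, hz]
  -- The affine change `(T - p) / (q - p)` sends the values `p`, `q` to `0`, `1`.
  obtain ⟨z, hz, hz'⟩ := exists_unit_vector_of_inner_eq_zero_one
    ((q - p)⁻¹ • (T - p • (1 : E →L[ℂ] E))) hx hy (by rw [hform x hx, hp, sub_self, mul_zero])
    (by rw [hform y hy, hq, inv_mul_cancel₀ hqp]) (t := t) ⟨ht, by linarith⟩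
  refine ⟨z, hz, ?_⟩
  rw [hform z hz, inv_mul_eq_iff_eq_mul₀ hqp] at hz'
  have hs' : (s : ℂ) = 1 - t := by
    rw [eq_sub_iff_add_eq, ← Complex.ofReal_add, hst, Complex.ofReal_one]
  rw [Complex.real_smul, Complex.real_smul, hs']
  linear_combination hz'

end NumericalRange

theorem convex_numericalRange (A : X →L[ℂ] X) : Convex ℝ (numericalRange A) :=
  (convex_setOf_inner_apply A).closure

/-- A point `z` at distance at least `r > 0` from the numerical range makes the form of `z - A`
bounded below by `r * ‖x‖ ^ 2`, so `z - A` is invertible by Lax–Milgram. -/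
theorem spectrum_subset_numericalRange (A : X →L[ℂ] X) : spectrum ℂ A ⊆ numericalRange A := by
  intro z hz
  by_contra hzn
  obtain ⟨r, hr, hball⟩ := Metric.isOpen_iff.mp isClosed_closure.isOpen_compl z hzn
  refine hz (ContinuousLinearMap.isUnit_of_forall_le_norm_inner_map _ (c := ⟨r, hr.le⟩) hr
    fun x => ?_)
  rcases eq_or_ne x 0 with rfl | hx
  · simp
  have hx' : ‖x‖ ≠ 0 := norm_ne_zero_iff.mpr hx
  set y : X := ((‖x‖⁻¹ : ℝ) : ℂ) • x with hy
  have hy1 : ‖y‖ = 1 := by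
    rw [hy, norm_smul, Complex.norm_real, norm_inv, norm_norm, inv_mul_cancel₀ hx']
  have hxy : x = (‖x‖ : ℂ) • y := by
    rw [hy, smul_smul, ← Complex.ofReal_mul, mul_inv_cancel₀ hx', Complex.ofReal_one, one_smul]
  have hfar : r ≤ ‖⟪y, A y⟫_ℂ - z‖ := by
    by_contra! hlt
    exact hball (by rwa [Metric.mem_ball, dist_eq_norm]) (subset_closure ⟨y, hy1, rfl⟩)
  have hform : ⟪(algebraMap ℂ (X →L[ℂ] X) z - A) x, x⟫_ℂ =
      (‖x‖ : ℂ) ^ 2 * conj (z - ⟪y, A y⟫_ℂ) := by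
    rw [← inner_conj_symm]
    conv_lhs => rw [hxy]
    simp only [Algebra.algebraMap_eq_smul_one, map_smul, sub_apply, smul_apply, one_apply_eq_self, inner_smul_left,
      inner_smul_right, inner_sub_right, Complex.conj_ofReal, map_mul, map_sub,
      inner_self_eq_norm_sq_to_K, hy1]
    simp
    ring
  rw [hform, norm_mul, RCLike.norm_conj, norm_sub_rev, norm_pow, Complex.norm_real, norm_norm]
  exact mul_le_mul_of_nonneg_left hfar (by positivity)

/-! ### Symbol curves and matrix entries -/

lemma mem_symbolCurve_iff {a b c z : ℂ} :
    z ∈ symbolCurve a b c ↔ ∃ w : ℂ, ‖w‖ = 1 ∧ z = a * w + b + c * w⁻¹ := by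
  constructor
  · rintro ⟨θ, -, rfl⟩
    exact ⟨Complex.exp (Complex.I * θ), by rw [mul_comm, Complex.norm_exp_ofReal_mul_I],
      by rw [Complex.exp_neg]⟩
  · rintro ⟨w, hw, rfl⟩
    have hexp : Complex.exp (Complex.I * (w.arg : ℂ)) = w := by
      have := Complex.norm_mul_exp_arg_mul_I w
      rwa [hw, Complex.ofReal_one, one_mul, mul_comm] at this
    rcases le_or_gt 0 w.arg with h | h
    · exact ⟨w.arg, ⟨h, by linarith [Complex.arg_le_pi w, Real.pi_pos]⟩,
        by rw [Complex.exp_neg, hexp]⟩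
    · refine ⟨w.arg + 2 * Real.pi, ⟨by linarith [Complex.neg_pi_lt_arg w, Real.pi_pos],
        by linarith⟩, ?_⟩
      have hexp' : Complex.exp (Complex.I * ((w.arg + 2 * Real.pi : ℝ) : ℂ)) = w := by
        rw [show Complex.I * ((w.arg + 2 * Real.pi : ℝ) : ℂ) =
          Complex.I * w.arg + 2 * Real.pi * Complex.I by push_cast; ring,
          Complex.exp_periodic, hexp]
      rw [Complex.exp_neg, hexp']

lemma isCompact_iUnion_symbolCurve {U V W : Set ℂ} (hU : IsCompact U) (hV : IsCompact V)
    (hW : IsCompact W) : IsCompact (⋃ a ∈ U, ⋃ b ∈ V, ⋃ c ∈ W, symbolCurve a b c) := by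
  have himage : (⋃ a ∈ U, ⋃ b ∈ V, ⋃ c ∈ W, symbolCurve a b c) =
      (fun p : ((ℂ × ℂ) × ℂ) × ℂ => p.1.1.1 * p.2 + p.1.1.2 + p.1.2 * p.2⁻¹) ''
        (((U ×ˢ V) ×ˢ W) ×ˢ Metric.sphere (0 : ℂ) 1) := by
    ext z
    simp only [Set.mem_iUnion, mem_symbolCurve_iff, Set.mem_image, Set.mem_prod,
      mem_sphere_zero_iff_norm, Prod.exists]
    constructor
    · rintro ⟨a, ha, b, hb, c, hc, w, hw, rfl⟩
      exact ⟨a, b, c, w, ⟨⟨⟨ha, hb⟩, hc⟩, hw⟩, rfl⟩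
    · rintro ⟨a, b, c, w, ⟨⟨⟨ha, hb⟩, hc⟩, hw⟩, rfl⟩
      exact ⟨a, ha, b, hb, c, hc, w, hw, rfl⟩
  rw [himage]
  refine (((hU.prod hV).prod hW).prod (isCompact_sphere 0 1)).image_of_continuousOn ?_
  refine ContinuousOn.add (by fun_prop) (ContinuousOn.mul (by fun_prop) ?_)
  refine ContinuousOn.inv₀ (by fun_prop) fun p hp => ?_
  exact norm_ne_zero_iff.mp (by rw [mem_sphere_zero_iff_norm.mp hp.2]; exact one_ne_zero)

lemma norm_entry_le_matrixNorm {N : ℕ} (B : Matrix (Fin N) (Fin N) ℂ) (i j : Fin N) :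
    ‖B i j‖ ≤ matrixNorm B := by
  have h := (Matrix.toEuclideanCLM (𝕜 := ℂ) B).le_opNorm (EuclideanSpace.single j 1)
  rw [PiLp.norm_single, norm_one, mul_one] at h
  refine le_trans ?_ h
  have h' := PiLp.norm_apply_le (Matrix.toEuclideanCLM (𝕜 := ℂ) B (EuclideanSpace.single j 1)) i
  simpa using h'

/-! ### Quadratic forms of tridiagonal operators -/

section Tridiagonal

variable {e : HilbertBasis ℤ ℂ X} {A : X →L[ℂ] X} {U : ℤ → Set ℂ}

lemma norm_entry_le (e : HilbertBasis ℤ ℂ X) (A : X →L[ℂ] X) (i j : ℤ) :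
    ‖entry e A i j‖ ≤ ‖A‖ := by
  calc ‖entry e A i j‖ ≤ ‖e i‖ * ‖A (e j)‖ := norm_inner_le_norm _ _
    _ ≤ ‖e i‖ * (‖A‖ * ‖e j‖) := by gcongr; exact A.le_opNorm _
    _ = ‖A‖ := by rw [e.orthonormal.1 i, e.orthonormal.1 j, one_mul, mul_one]

lemma entry_sub_one_mem (hA : A ∈ M e (-1) 1 U) (i : ℤ) : entry e A (i - 1) i ∈ U (-1) :=
  (hA i (-1)).1 (by norm_num)

lemma entry_self_mem (hA : A ∈ M e (-1) 1 U) (i : ℤ) : entry e A i i ∈ U 0 := by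
  simpa using (hA i 0).1 (by norm_num)

lemma entry_add_one_mem (hA : A ∈ M e (-1) 1 U) (i : ℤ) : entry e A (i + 1) i ∈ U 1 :=
  (hA i 1).1 (by norm_num)

lemma ext_inner_basis {x y : X} (h : ∀ i, ⟪e i, x⟫_ℂ = ⟪e i, y⟫_ℂ) : x = y :=
  e.repr.injective (lp.ext (funext fun i => by
    rw [e.repr_apply_apply, e.repr_apply_apply, h i]))

lemma inner_basis (i j : ℤ) : ⟪e i, e j⟫_ℂ = if i = j then 1 else 0 :=
  orthonormal_iff_ite.mp e.orthonormal i j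

lemma apply_basis (hA : A ∈ M e (-1) 1 U) (j : ℤ) :
    A (e j) = entry e A (j - 1) j • e (j - 1) + entry e A j j • e j +
      entry e A (j + 1) j • e (j + 1) := by
  refine ext_inner_basis (e := e) fun i => ?_
  simp only [inner_add_right, inner_smul_right, inner_basis]
  change entry e A i j = _
  rcases eq_or_ne i (j - 1) with rfl | h1
  · rw [if_pos rfl, if_neg (by omega), if_neg (by omega)]; ring
  rcases eq_or_ne i j with rfl | h2
  · rw [if_pos rfl, if_neg (by omega), if_neg (by omega)]; ring
  rcases eq_or_ne i (j + 1) with rfl | h3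
  · rw [if_pos rfl, if_neg (by omega), if_neg (by omega)]; ring
  · rw [if_neg h1, if_neg h2, if_neg h3]
    have := (hA j (i - j)).2 (by omega)
    rw [add_sub_cancel] at this
    rw [this]; ring

lemma continuousLinearMap_ext_basis {B C : X →L[ℂ] X} (e : HilbertBasis ℤ ℂ X)
    (h : ∀ j, B (e j) = C (e j)) : B = C := by
  refine ContinuousLinearMap.ext_on (s := Set.range e) ?_ ?_
  · rw [Submodule.dense_iff_topologicalClosure_eq_top, e.dense_span]
  · rintro _ ⟨j, rfl⟩
    exact h j

lemma hasSum_norm_inner_basis_sq (e : HilbertBasis ℤ ℂ X) (x : X) :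
    HasSum (fun i => ‖⟪e i, x⟫_ℂ‖ ^ 2) (‖x‖ ^ 2) := by
  have h := (e.hasSum_inner_mul_inner x x).mapL Complex.reCLM
  convert h using 1
  · ext i
    rw [← inner_conj_symm x (e i), Complex.conj_mul', ← Complex.ofReal_pow]
    exact (Complex.ofReal_re _).symm
  · rw [inner_self_eq_norm_sq_to_K]
    simp [← Complex.ofReal_pow]

/-- The expansion of the real part of the quadratic form of a tridiagonal operator, grouped by
pairs of neighbouring basis vectors. -/
lemma hasSum_re_mul_inner_apply (hA : A ∈ M e (-1) 1 U) (α : ℂ) (x : X) :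
    HasSum (fun i => (α * entry e A (i - 1) i * (⟪e i, x⟫_ℂ * conj ⟪e (i - 1), x⟫_ℂ)).re +
      (α * entry e A i i * (⟪e i, x⟫_ℂ * conj ⟪e i, x⟫_ℂ)).re +
      (α * entry e A (i + 1) i * (⟪e i, x⟫_ℂ * conj ⟪e (i + 1), x⟫_ℂ)).re)
      (α * ⟪x, A x⟫_ℂ).re := by
  have h : HasSum (fun i => (α * ⟪x, A (⟪e i, x⟫_ℂ • e i)⟫_ℂ).re) (α * ⟪x, A x⟫_ℂ).re := by
    have h := (e.hasSum_repr x).mapL (innerSL ℂ x ∘L A)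
    simp only [e.repr_apply_apply] at h
    exact (h.mul_left α).mapL Complex.reCLM
  refine h.congr_fun fun i => ?_
  rw [map_smul, apply_basis hA i]
  simp only [inner_add_right, inner_smul_right, inner_conj_symm, ← Complex.add_re]
  congr 1
  ring

/-- Conjugating the second term merges both into `re ((p + conj q) * η * conj ξ)`; then `2 ‖η‖ ‖ξ‖ ≤
‖η‖ ^ 2 + ‖ξ‖ ^ 2`. -/
lemma re_add_re_le_of_norm_le {p q ξ η : ℂ} {γ : ℝ} (h : ‖p + conj q‖ ≤ γ) :
    (p * (η * conj ξ)).re + (q * (ξ * conj η)).re ≤ γ / 2 * (‖η‖ ^ 2 + ‖ξ‖ ^ 2) := by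
  have hγ0 : 0 ≤ γ := (norm_nonneg _).trans h
  have hq : (q * (ξ * conj η)).re = (conj q * (η * conj ξ)).re := by
    rw [← Complex.conj_re]
    simp only [map_mul, Complex.conj_conj]
    rw [mul_comm (conj ξ)]
  rw [hq, ← Complex.add_re, ← add_mul]
  refine (Complex.re_le_norm _).trans ?_
  rw [norm_mul, norm_mul, RCLike.norm_conj]
  calc _ ≤ γ * (‖η‖ * ‖ξ‖) := by gcongr
    _ ≤ _ := by nlinarith [mul_nonneg hγ0 (sq_nonneg (‖η‖ - ‖ξ‖))]

lemma summable_re_mul_of_norm_le {p ξ η : ℤ → ℂ} {C : ℝ} (hp : ∀ i, ‖p i‖ ≤ C)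
    (hξ : Summable fun i => ‖ξ i‖ ^ 2) (hη : Summable fun i => ‖η i‖ ^ 2) :
    Summable fun i => (p i * (η i * conj (ξ i))).re := by
  refine Summable.of_norm_bounded ((hη.add hξ).mul_left C) fun i => ?_
  have hC : 0 ≤ C := (norm_nonneg _).trans (hp 0)
  calc _ ≤ ‖p i * (η i * conj (ξ i))‖ := Complex.abs_re_le_norm _
    _ = ‖p i‖ * (‖η i‖ * ‖ξ i‖) := by rw [norm_mul, norm_mul, RCLike.norm_conj]
    _ ≤ C * (‖η i‖ ^ 2 + ‖ξ i‖ ^ 2) := by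
      gcongr
      · exact hp i
      · nlinarith [sq_nonneg (‖η i‖ - ‖ξ i‖), sq_nonneg ‖η i‖, sq_nonneg ‖ξ i‖]

/-- Bounds on the real parts of the diagonal entries and on the entries of the Hermitian part
next to the diagonal bound the real part of the quadratic form of a tridiagonal operator. -/
theorem re_mul_inner_apply_le (hA : A ∈ M e (-1) 1 U) (α : ℂ) {β γ : ℝ}
    (hβ : ∀ i, (α * entry e A i i).re ≤ β)
    (hγ : ∀ i, ‖α * entry e A i (i + 1) + conj (α * entry e A (i + 1) i)‖ ≤ γ) (x : X) :
    (α * ⟪x, A x⟫_ℂ).re ≤ (β + γ) * ‖x‖ ^ 2 := by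
  have hterms := hasSum_re_mul_inner_apply hA α x
  have hξ := hasSum_norm_inner_basis_sq e x
  generalize (α * ⟪x, A x⟫_ℂ).re = R at *
  generalize ‖x‖ ^ 2 = S at *
  obtain ⟨ξ, hξdef⟩ : ∃ ξ : ℤ → ℂ, ∀ i, ⟪e i, x⟫_ℂ = ξ i := ⟨_, fun _ => rfl⟩
  simp only [hξdef] at hterms hξ
  have hξ' : HasSum (fun i => ‖ξ (i + 1)‖ ^ 2) S :=
    (Equiv.hasSum_iff (Equiv.addRight (1 : ℤ))).mpr hξ
  have hF : Summable fun i => (α * entry e A i (i + 1) * (ξ (i + 1) * conj (ξ i))).re := by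
    refine summable_re_mul_of_norm_le (C := ‖α‖ * ‖A‖) (fun i => ?_) hξ.summable hξ'.summable
    rw [norm_mul]
    exact mul_le_mul_of_nonneg_left (norm_entry_le e A i (i + 1)) (norm_nonneg α)
  obtain ⟨F, hFdef⟩ : ∃ F : ℤ → ℝ,
      F = fun i => (α * entry e A i (i + 1) * (ξ (i + 1) * conj (ξ i))).re := ⟨_, rfl⟩
  rw [← hFdef] at hF
  have hF' : HasSum (fun i => F (i - 1)) (∑' i, F i) :=
    (Equiv.hasSum_iff (Equiv.subRight (1 : ℤ))).mpr hF.hasSum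
  -- Shifting the superdiagonal terms by one index puts both couplings of `ξ i` and `ξ (i + 1)` into
  -- the same summand without changing the sum.
  have hshift := hF.hasSum.add (hterms.sub hF')
  rw [add_sub_cancel] at hshift
  have hbound := (hξ.mul_left β).add ((hξ'.add hξ).mul_left (γ / 2))
  rw [show (β + γ) * S = β * S + γ / 2 * (S + S) by ring]
  refine hasSum_le (fun i => ?_) hshift hbound
  have hG : (α * entry e A i i * (ξ i * conj (ξ i))).re ≤ β * ‖ξ i‖ ^ 2 := by
    rw [Complex.mul_conj', ← Complex.ofReal_pow, Complex.re_mul_ofReal]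
    exact mul_le_mul_of_nonneg_right (hβ i) (sq_nonneg _)
  have hFH := re_add_re_le_of_norm_le (ξ := ξ i) (η := ξ (i + 1)) (hγ i)
  simp only [hFdef, sub_add_cancel]
  linarith

theorem numericalRange_subset_convexHull (h₀ : (U 0).Nonempty) (hc_neg : IsCompact (U (-1)))
    (hc₀ : IsCompact (U 0)) (hc₁ : IsCompact (U 1)) (hA : A ∈ M e (-1) 1 U) :
    numericalRange A ⊆
      convexHull ℝ (⋃ a ∈ U (-1), ⋃ b ∈ U 0, ⋃ c ∈ U 1, symbolCurve a b c) := by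
  set K := ⋃ a ∈ U (-1), ⋃ b ∈ U 0, ⋃ c ∈ U 1, symbolCurve a b c with hK
  intro z hz
  by_contra hzK
  obtain ⟨f, u, hfu, huz⟩ := RCLike.geometric_hahn_banach_closed_point (𝕜 := ℂ)
    (convex_convexHull ℝ K)
    (isCompact_convexHull (isCompact_iUnion_symbolCurve hc_neg hc₀ hc₁)).isClosed hzK
  have hf (w : ℂ) : f w = f 1 * w := by
    rw [mul_comm, ← smul_eq_mul, ← map_smul, smul_eq_mul, mul_one]
  set α := f 1
  -- The three sets vary independently, so this one extremal `b` may be combined with any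
  -- off-diagonal entries of `A`.
  obtain ⟨b, hb, hbmax⟩ := hc₀.exists_isMaxOn h₀ (f := fun b => (α * b).re) (by fun_prop)
  have hoff (i : ℤ) : ‖α * entry e A i (i + 1) + conj (α * entry e A (i + 1) i)‖ ≤
      u - (α * b).re := by
    have ha : entry e A i (i + 1) ∈ U (-1) := by simpa using entry_sub_one_mem hA (i + 1)
    have hc := entry_add_one_mem hA i
    generalize entry e A i (i + 1) = a at *
    generalize entry e A (i + 1) i = c at *
    -- At this `w` the curve of `(a, b, c)` is extremal in the direction `α`.
    obtain ⟨w, hw, hw'⟩ := exists_norm_eq_one_mul_eq_norm (α * a + conj (α * c))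
    have hmem : a * w + b + c * w⁻¹ ∈ K := by
      simp only [hK, Set.mem_iUnion]
      exact ⟨a, ha, b, hb, c, hc, mem_symbolCurve_iff.mpr ⟨w, hw, rfl⟩⟩
    have hlt := hfu _ (subset_convexHull ℝ K hmem)
    rw [hf] at hlt
    have hwinv : w⁻¹ = conj w := Complex.inv_eq_conj hw
    have hre := congrArg Complex.re hw'
    have hcw : (α * c * conj w).re = (conj (α * c) * w).re := by
      rw [← Complex.conj_re]; simp
    rw [hwinv,
      show α * (a * w + b + c * conj w) = α * a * w + α * b + α * c * conj w by ring] at hlt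
    rw [Complex.ofReal_re, show w * (α * a + conj (α * c)) = α * a * w + conj (α * c) * w by ring,
      Complex.add_re] at hre
    change (α * a * w + α * b + α * c * conj w).re < u at hlt
    rw [Complex.add_re, Complex.add_re] at hlt
    linarith
  have hle : numericalRange A ⊆ {w | (α * w).re ≤ u} := by
    refine closure_minimal ?_ (isClosed_le (by fun_prop) continuous_const)
    rintro _ ⟨x, hx, rfl⟩
    have := re_mul_inner_apply_le hA α (fun i => hbmax (entry_self_mem hA i)) hoff x
    rwa [hx, one_pow, mul_one, add_sub_cancel] at this
  rw [hf] at huz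
  exact absurd (hle hz) (not_le.mpr huz)

end Tridiagonal

/-! ### Spectra of pseudo-ergodic and Laurent operators -/

section Spectrum

variable {e : HilbertBasis ℤ ℂ X} {A B : X →L[ℂ] X} {U : ℤ → Set ℂ}

/-- If a tridiagonal operator is arbitrarily close to being Laurent on arbitrarily long blocks,
then the symbol curve of the limiting Laurent operator consists of approximate eigenvalues. -/
theorem symbolCurve_subset_spectrum {a b c : ℂ} (hA : A ∈ M e (-1) 1 U)
    (hblock : ∀ ε : ℝ, 0 < ε → ∀ N : ℕ, ∃ k : ℤ, ∀ n : ℕ, n < N →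
      ‖entry e A (k + n - 1) (k + n) - a‖ ≤ ε ∧ ‖entry e A (k + n) (k + n) - b‖ ≤ ε ∧
        ‖entry e A (k + n + 1) (k + n) - c‖ ≤ ε) :
    symbolCurve a b c ⊆ spectrum ℂ A := by
  intro z hz hunit
  obtain ⟨w, hw, rfl⟩ := mem_symbolCurve_iff.mp hz
  have hw0 : w ≠ 0 := norm_ne_zero_iff.mp (by rw [hw]; exact one_ne_zero)
  generalize hzdef : a * w + b + c * w⁻¹ = z at *
  obtain ⟨R, hR⟩ := hunit.exists_left_inv
  -- The wave below has norm `√N`, while its residual stays below `2‖a‖ + 2‖c‖ + 3` for every `N`;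
  -- this `N` is too large for the left inverse `R`. The tolerance `1 / (N + 1)` keeps the `N` entry
  -- errors below `3` in total.
  obtain ⟨N, hN⟩ := exists_nat_gt ((‖R‖ * (2 * ‖a‖ + 2 * ‖c‖ + 3)) ^ 2)
  obtain ⟨k, hk⟩ := hblock (1 / (N + 1)) (by positivity) N
  let x : X := ∑ n ∈ Finset.range N, w ^ n • e (k + n)
  have hnorm_e (i : ℤ) : ‖e i‖ = 1 := e.orthonormal.1 i
  have hx : ‖x‖ ^ 2 = N := by
    have horth : Orthonormal ℂ (fun n : ℕ => e (k + n)) :=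
      e.orthonormal.comp (fun n : ℕ => k + n) fun m n h => by simpa using h
    have h := horth.inner_sum (fun n => w ^ n) (fun n => w ^ n) (Finset.range N)
    rw [inner_self_eq_norm_sq_to_K] at h
    simp only [Complex.conj_mul', norm_pow, hw, one_pow, Complex.ofReal_one, Finset.sum_const,
      Finset.card_range, nsmul_eq_mul, mul_one] at h
    change (‖x‖ : ℂ) ^ 2 = N at h
    exact_mod_cast h
  -- The off-diagonal parts of the residual telescope in `g` and `h`, leaving only terms at the two
  -- ends of the block.
  let g : ℕ → X := fun n => w ^ n • e (k + n - 1)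
  let h : ℕ → X := fun n => (w⁻¹ * w ^ n) • e (k + n)
  have hg (n : ℕ) : ‖g n‖ = 1 := by
    simp only [g]; rw [norm_smul, norm_pow, hw, one_pow, hnorm_e, one_mul]
  have hh (n : ℕ) : ‖h n‖ = 1 := by
    simp only [h]
    rw [norm_smul, norm_mul, norm_inv, norm_pow, hw, one_pow, hnorm_e, inv_one, one_mul, one_mul]
  have hg1 (n : ℕ) : g (n + 1) = (w ^ n * w) • e (k + n) := by
    simp only [g]; rw [pow_succ]; congr 2; push_cast; ring
  have hh1 (n : ℕ) : h (n + 1) = w ^ n • e (k + n + 1) := by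
    simp only [h]
    rw [pow_succ, mul_comm (w ^ n), inv_mul_cancel_left₀ hw0]; congr 2; push_cast; ring
  let err : ℕ → X := fun n => w ^ n • ((entry e A (k + n - 1) (k + n) - a) • e (k + n - 1) +
    (entry e A (k + n) (k + n) - b) • e (k + n) +
    (entry e A (k + n + 1) (k + n) - c) • e (k + n + 1))
  have herr (n : ℕ) (hn : n < N) : ‖err n‖ ≤ 3 * (1 / (N + 1)) := by
    obtain ⟨h1, h2, h3⟩ := hk n hn
    simp only [err]
    rw [norm_smul, norm_pow, hw, one_pow, one_mul]
    refine (norm_add₃_le).trans ?_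
    rw [norm_smul, norm_smul, norm_smul, hnorm_e, hnorm_e, hnorm_e]
    linarith
  have hterm (n : ℕ) : w ^ n • (A (e (k + n)) - z • e (k + n)) =
      a • (g n - g (n + 1)) + c • (h (n + 1) - h n) + err n := by
    rw [apply_basis hA, hg1, hh1, ← hzdef]
    simp only [g, h, err]
    module
  have hAx : A x - z • x = a • (g 0 - g N) + c • (h N - h 0) +
      ∑ n ∈ Finset.range N, err n := by
    rw [← Finset.sum_range_sub' g, ← Finset.sum_range_sub h,
      Finset.smul_sum (r := a), Finset.smul_sum (r := c),
      ← Finset.sum_add_distrib, ← Finset.sum_add_distrib]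
    simp only [← hterm]
    simp only [x, map_sum, map_smul, Finset.smul_sum, smul_sub, Finset.sum_sub_distrib,
      smul_comm z]
  have hbound : ‖A x - z • x‖ ≤ 2 * ‖a‖ + 2 * ‖c‖ + 3 := by
    rw [hAx]
    refine norm_add₃_le.trans ?_
    rw [norm_smul, norm_smul]
    have h1 : ‖g 0 - g N‖ ≤ 2 := (norm_sub_le _ _).trans (by rw [hg, hg]; norm_num)
    have h2 : ‖h N - h 0‖ ≤ 2 := (norm_sub_le _ _).trans (by rw [hh, hh]; norm_num)
    have h3 : ‖∑ n ∈ Finset.range N, err n‖ ≤ 3 := by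
      refine (norm_sum_le_of_le _ fun n hn => herr n (Finset.mem_range.mp hn)).trans ?_
      rw [Finset.sum_const, Finset.card_range, nsmul_eq_mul]
      have hN1 : (0 : ℝ) < N + 1 := by positivity
      rw [mul_one_div, mul_div_assoc', div_le_iff₀ hN1]
      linarith
    nlinarith [norm_nonneg a, norm_nonneg c]
  have hxR : x = R (z • x - A x) := by
    have := congrArg (fun T : X →L[ℂ] X => T x) hR
    simpa [Algebra.algebraMap_eq_smul_one] using this.symm
  have hxle : ‖x‖ ≤ ‖R‖ * (2 * ‖a‖ + 2 * ‖c‖ + 3) := by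
    conv_lhs => rw [hxR]
    refine (R.le_opNorm _).trans (mul_le_mul_of_nonneg_left ?_ (norm_nonneg R))
    rwa [norm_sub_rev]
  have := pow_le_pow_left₀ (norm_nonneg x) hxle 2
  rw [hx] at this
  exact absurd hN (not_lt.mpr this)

theorem symbolCurve_subset_spectrum_of_mem_psiE {a b c : ℂ} (hA : A ∈ PsiE e (-1) 1 U)
    (ha : a ∈ U (-1)) (hb : b ∈ U 0) (hc : c ∈ U 1) : symbolCurve a b c ⊆ spectrum ℂ A := by
  refine symbolCurve_subset_spectrum hA.1 fun ε hε N => ?_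
  -- One extra index at each end gives each of the `N` inner columns both its neighbours; hence the
  -- starting point `k + 1` below.
  let T : Matrix (Fin (N + 2)) (Fin (N + 2)) ℂ := Matrix.of fun i j =>
    if (i : ℤ) - j = -1 then a else if (i : ℤ) - j = 0 then b else
      if (i : ℤ) - j = 1 then c else 0
  have hT : T ∈ MFin (-1) 1 U (N + 2) := by
    intro i j
    simp only [T, Matrix.of_apply]
    generalize (i : ℤ) - j = d
    refine ⟨fun hd => ?_, fun hd => ?_⟩
    · obtain rfl | rfl | rfl : d = -1 ∨ d = 0 ∨ d = 1 := by omega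
      · simpa using ha
      · simpa using hb
      · simpa using hc
    · rw [if_neg (by omega), if_neg (by omega), if_neg (by omega)]
  obtain ⟨k, hk⟩ := hA.2 ε hε (N + 2) T hT
  refine ⟨k + 1, fun n hn => ?_⟩
  have key (i j : Fin (N + 2)) : ‖entry e A (k + i) (k + j) - T i j‖ ≤ ε :=
    (norm_entry_le_matrixNorm (compression e A k (N + 2) - T) i j).trans hk
  refine ⟨?_, ?_, ?_⟩
  · convert key ⟨n, by omega⟩ ⟨n + 1, by omega⟩ using 3
    · congr 1 <;> push_cast <;> ring
    · simp [T]
  · convert key ⟨n + 1, by omega⟩ ⟨n + 1, by omega⟩ using 3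
    · congr 1 <;> push_cast <;> ring
    · simp [T]
  · convert key ⟨n + 2, by omega⟩ ⟨n + 1, by omega⟩ using 3
    · congr 1 <;> push_cast <;> ring
    · simp [T]

/-- The bilateral shift `e i ↦ e (i + 1)`. -/
noncomputable def shift (e : HilbertBasis ℤ ℂ X) : X ≃ₗᵢ[ℂ] X :=
  e.repr.trans (HilbertBasis.mk (v := fun i : ℤ => e (i + 1))
    (e.orthonormal.comp _ (add_left_injective 1)) (by
      have hrange : Set.range (fun i : ℤ => e (i + 1)) = Set.range e :=
        (Equiv.addRight (1 : ℤ)).surjective.range_comp e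
      rw [hrange, e.dense_span])).repr.symm

lemma shift_basis (e : HilbertBasis ℤ ℂ X) (i : ℤ) : shift e (e i) = e (i + 1) := by
  rw [shift, LinearIsometryEquiv.trans_apply, e.repr_self, HilbertBasis.repr_symm_single,
    HilbertBasis.coe_mk]

lemma shift_symm_basis (e : HilbertBasis ℤ ℂ X) (i : ℤ) : (shift e).symm (e i) = e (i - 1) := by
  rw [LinearIsometryEquiv.symm_apply_eq, shift_basis, sub_add_cancel]

/-- The Laurent operator with the entries `a`, `b`, `c` on the diagonals `-1`, `0`, `1`. -/
noncomputable def laurent (e : HilbertBasis ℤ ℂ X) (a b c : ℂ) : X →L[ℂ] X :=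
  a • ((shift e).symm.toContinuousLinearEquiv : X →L[ℂ] X) + b • (1 : X →L[ℂ] X) +
    c • ((shift e).toContinuousLinearEquiv : X →L[ℂ] X)

lemma laurent_apply (a b c : ℂ) (x : X) :
    laurent e a b c x = a • (shift e).symm x + b • x + c • shift e x := rfl

lemma entry_laurent (a b c : ℂ) (i j : ℤ) : entry e (laurent e a b c) i j =
    (if i = j - 1 then a else 0) + (if i = j then b else 0) + (if i = j + 1 then c else 0) := by
  simp only [entry, laurent_apply, shift_basis, shift_symm_basis, inner_add_right,
    inner_smul_right, inner_basis, mul_ite, mul_one, mul_zero]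

lemma laurent_mem_L {a b c : ℂ} (ha : a ∈ U (-1)) (hb : b ∈ U 0) (hc : c ∈ U 1) :
    laurent e a b c ∈ L e (-1) 1 U := by
  refine ⟨fun i k => ⟨fun hk => ?_, fun hk => ?_⟩, fun i j => ?_⟩
  · rw [entry_laurent]
    obtain rfl | rfl | rfl : k = -1 ∨ k = 0 ∨ k = 1 := by omega
    · rwa [if_pos (by omega), if_neg (by omega), if_neg (by omega), add_zero, add_zero]
    · rwa [if_neg (by omega), if_pos (by omega), if_neg (by omega), add_zero, zero_add]
    · rwa [if_neg (by omega), if_neg (by omega), if_pos (by omega), add_zero, zero_add]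
  · rw [entry_laurent, if_neg (by omega), if_neg (by omega), if_neg (by omega), add_zero, add_zero]
  · simp only [entry_laurent, add_left_inj, show i + 1 = j + 1 - 1 ↔ i = j - 1 by omega]

lemma entry_add_right (hB : B ∈ L e (-1) 1 U) (k j : ℤ) : entry e B (k + j) j = entry e B k 0 := by
  induction j using Int.induction_on with
  | zero => rw [add_zero]
  | succ j ih => rw [← add_assoc, ← hB.2, ih]
  | pred j ih => rw [hB.2, ← ih]; congr 1 <;> ring

lemma eq_laurent (hB : B ∈ L e (-1) 1 U) :
    B = laurent e (entry e B (-1) 0) (entry e B 0 0) (entry e B 1 0) := by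
  refine continuousLinearMap_ext_basis e fun j => ?_
  rw [apply_basis hB.1, laurent_apply, shift_basis, shift_symm_basis, ← entry_add_right hB (-1) j,
    ← entry_add_right hB 0 j, ← entry_add_right hB 1 j, zero_add, neg_add_eq_sub, add_comm 1 j]

open Polynomial in
-- With `S` the shift, `z - laurent e a b c = -S⁻¹ p(S)` for `p = a + (b - z) X + c X²`. If this is
-- singular, spectral mapping gives a root `w` of `p` in the spectrum of the unitary `S`, so `‖w‖ =
-- 1`, and `z` is the symbol at `w⁻¹`.
theorem spectrum_laurent_subset (a b c : ℂ) :
    spectrum ℂ (laurent e a b c) ⊆ symbolCurve a b c := by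
  intro z hz
  let S : X →L[ℂ] X := ((shift e).toContinuousLinearEquiv : X →L[ℂ] X)
  let S' : X →L[ℂ] X := ((shift e).symm.toContinuousLinearEquiv : X →L[ℂ] X)
  have hS'S : S' * S = 1 := ContinuousLinearMap.ext fun x => (shift e).symm_apply_apply x
  have hSS' : S * S' = 1 := ContinuousLinearMap.ext fun x => (shift e).apply_symm_apply x
  let p : ℂ[X] := C a + C (b - z) * Polynomial.X + C c * Polynomial.X ^ 2
  have hp : aeval S p =
      algebraMap ℂ _ a + algebraMap ℂ _ (b - z) * S + algebraMap ℂ _ c * S ^ 2 := by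
    simp [p]
  have hfactor : algebraMap ℂ (X →L[ℂ] X) z - laurent e a b c = -(S' * aeval S p) := by
    have h2 : S' * S ^ 2 = S := by rw [sq, ← mul_assoc, hS'S, one_mul]
    rw [hp]
    simp only [Algebra.algebraMap_eq_smul_one, mul_add, smul_mul_assoc, one_mul, mul_smul_comm,
      hS'S, h2, mul_one]
    change z • (1 : X →L[ℂ] X) - (a • S' + b • (1 : X →L[ℂ] X) + c • S) = _
    module
  have hS'unit : IsUnit S' := ⟨⟨S', S, hS'S, hSS'⟩, rfl⟩
  have h0 : (0 : ℂ) ∈ spectrum ℂ (aeval S p) := by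
    rw [spectrum.zero_mem_iff]
    intro hunit
    refine hz ?_
    change IsUnit (algebraMap ℂ (X →L[ℂ] X) z - laurent e a b c)
    rw [hfactor]
    exact (hS'unit.mul hunit).neg
  have : Nontrivial X := ⟨e 0, 0, e.orthonormal.ne_zero 0⟩
  rw [spectrum.map_polynomial_aeval] at h0
  obtain ⟨w, hwS, hw⟩ := h0
  have hSunitary : S ∈ unitary (X →L[ℂ] X) :=
    (Unitary.linearIsometryEquiv.symm (shift e)).2
  have hw1 : ‖w‖ = 1 := spectrum.norm_eq_one_of_unitary hSunitary hwS
  have hw0 : w ≠ 0 := norm_ne_zero_iff.mp (by rw [hw1]; exact one_ne_zero)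
  refine mem_symbolCurve_iff.mpr ⟨w⁻¹, by rw [norm_inv, hw1, inv_one], ?_⟩
  simp only [p, eval_add, eval_mul, eval_C, eval_X, eval_pow] at hw
  rw [inv_inv]
  field_simp
  linear_combination -hw

theorem spectrum_eq_symbolCurve (hB : B ∈ L e (-1) 1 U) :
    spectrum ℂ B = symbolCurve (entry e B (-1) 0) (entry e B 0 0) (entry e B 1 0) := by
  refine Set.Subset.antisymm ?_ ?_
  · conv_lhs => rw [eq_laurent hB]
    exact spectrum_laurent_subset _ _ _
  -- Every block of a Laurent operator matches the constant diagonals with zero error.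
  · refine symbolCurve_subset_spectrum hB.1 fun ε hε N => ⟨0, fun n _ => ?_⟩
    rw [show (0 + n - 1 : ℤ) = -1 + (0 + n) by ring, add_comm (0 + (n : ℤ)) 1,
      entry_add_right hB, entry_add_right hB, ← entry_add_right hB 0 (0 + n),
      zero_add (0 + (n : ℤ))]
    simp [hε.le]

theorem iUnion_spectrum_laurent (e : HilbertBasis ℤ ℂ X) (U : ℤ → Set ℂ) :
    (⋃ B ∈ L e (-1) 1 U, spectrum ℂ B) =
      ⋃ a ∈ U (-1), ⋃ b ∈ U 0, ⋃ c ∈ U 1, symbolCurve a b c := by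
  refine Set.Subset.antisymm ?_ ?_
  · simp only [Set.iUnion_subset_iff]
    intro B hB
    rw [spectrum_eq_symbolCurve hB]
    intro z hz
    simp only [Set.mem_iUnion]
    exact ⟨_, by simpa using (hB.1 0 (-1)).1 (by norm_num), _, entry_self_mem hB.1 0, _,
      by simpa using entry_add_one_mem hB.1 0, hz⟩
  · simp only [Set.iUnion_subset_iff]
    intro a ha b hb c hc z hz
    have hmem := laurent_mem_L (e := e) ha hb hc
    simp only [Set.mem_iUnion]
    refine ⟨_, hmem, ?_⟩
    rw [spectrum_eq_symbolCurve hmem]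
    simpa [entry_laurent] using hz

end Spectrum

end BandOp

theorem mainTheorem1 (e : HilbertBasis ℤ ℂ BandOp.X) (U : ℤ → Set ℂ)
    (hne_neg : (U (-1)).Nonempty) (hne₀ : (U 0).Nonempty) (hne₁ : (U 1).Nonempty)
    (hc_neg : IsCompact (U (-1))) (hc₀ : IsCompact (U 0)) (hc₁ : IsCompact (U 1))
    (A : BandOp.X →L[ℂ] BandOp.X) (hA : A ∈ BandOp.PsiE e (-1) 1 U) :
    BandOp.numericalRange A = convexHull ℝ (⋃ B ∈ BandOp.L e (-1) 1 U, spectrum ℂ B) ∧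
    convexHull ℝ (⋃ B ∈ BandOp.L e (-1) 1 U, spectrum ℂ B) =
      convexHull ℝ (⋃ a ∈ U (-1), ⋃ b ∈ U 0, ⋃ c ∈ U 1, BandOp.symbolCurve a b c) ∧
    (Convex ℝ (⋃ B ∈ BandOp.L e (-1) 1 U, spectrum ℂ B) →
      spectrum ℂ A = BandOp.numericalRange A) := by
  rw [BandOp.iUnion_spectrum_laurent]
  have hcurve : (⋃ a ∈ U (-1), ⋃ b ∈ U 0, ⋃ c ∈ U 1, BandOp.symbolCurve a b c) ⊆
      spectrum ℂ A := by
    simp only [Set.iUnion_subset_iff]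
    exact fun a ha b hb c hc => BandOp.symbolCurve_subset_spectrum_of_mem_psiE hA ha hb hc
  have hspec := BandOp.spectrum_subset_numericalRange A
  have hrange : BandOp.numericalRange A =
      convexHull ℝ (⋃ a ∈ U (-1), ⋃ b ∈ U 0, ⋃ c ∈ U 1, BandOp.symbolCurve a b c) :=
    Set.Subset.antisymm
      (BandOp.numericalRange_subset_convexHull hne₀ hc_neg hc₀ hc₁ hA.1)
      (convexHull_min (hcurve.trans hspec) (BandOp.convex_numericalRange A))
  refine ⟨hrange, rfl, fun hconv => Set.Subset.antisymm hspec ?_⟩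
  rw [hrange, hconv.convexHull_eq]
  exact hcurve
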